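/- Let $T>0$, let $B=(B^1,\dots,B^d)$ be a standard $d$-dimensional Brownian motion on a probability space $(\Omega,\mathcal F,P)$, and let $H=L^2([0,T];\mathbb R^d)$ with $\langle g,h\rangle_{L^2([0,T])}=\int_0^T g(t)\cdot h(t)\,dt$. For $h\in H$ let $B(h)=\int_0^T h(t)\cdot dB_t$ be the Wiener integral. Let $D$ be the Malliavin derivative, i.e. the closure in $L^2(\Omega)\times L^2(\Omega;H)$ of the operator $D f(B(h_1),\dots,B(h_n))=\sum_{i}\partial_i f(B(h_1),\dots,B(h_n))\,h_i$, where $h_i\in H$ and $f\in C^\infty(\mathbb R^n)$ has, together with all its partial derivatives, polynomial growth; let $\mathbb D^{1,2}$ be its domain. Let $X_T=(X_T^1,\dots,X_T^m)$ be a random vector with $X_T^i\in\mathbb D^{1,2}$ for all $i$ (for example the solution at time $T$ of an $m$-dimensional stochastic differential equation driven by $B$, with components in $\mathbb D^{1,2}$). Let $\gamma_{X_T}(i,j)=\langle DX_T^i,DX_T^j\rangle_{L^2([0,T])}$ be its Malliavin matrix and assume that $\gamma_{X_T}$ is almost surely invertible. For $k=1,\dots,m$ put $$u_k(t)=\sum_{j=1}^m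 \gamma_{X_T}^{-1}(k,j)\,D_tX_T^j,\qquad t\in[0,T].$$ Then, for each $k=1,\dots,m$, almost surely $$\langle DX_T^i,u_k\rangle_{L^2([0,T])}=\delta_{i,k}\quad\text{for all } i=1,\dots,m,$$ where $\delta_{i,k}$ is the Kronecker delta; in particular $\langle DX_T^k,u_k\rangle_{L^2([0,T])}=1$. Thus $u_k$ is a covering vector field for the $k$-th component of $X_T$: moreover, for every $\varphi\in C^1(\mathbb R^m)$ with compact support, $\varphi(X_T)\in\mathbb D^{1,2}$ and, almost surely, $$\langle D(\varphi(X_T)),u_k\rangle_{L^2([0,T])}=\partial_k\varphi(X_T).$$ -/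

import Mathlib

open MeasureTheory ProbabilityTheory
open scoped NNReal ENNReal

noncomputable section

namespace Malliavin

/-- The Hilbert space `H = L²([0,T]; ℝᵈ)` with inner product `⟨g, h⟩ = ∫₀ᵀ g(t) · h(t) dt`. -/
abbrev PathSpace (d : ℕ) (T : ℝ≥0) : Type :=
  Lp (EuclideanSpace ℝ (Fin d)) 2 ((volume : Measure ℝ).restrict (Set.Icc (0 : ℝ) T))

variable {Ω : Type*} [MeasurableSpace Ω] {d m : ℕ}

/-- `B = (B¹, …, Bᵈ)` is a standard `d`-dimensional Brownian motion: its components are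
independent real Brownian motions. -/
structure IsStandardBrownian (B : Fin d → ℝ≥0 → Ω → ℝ) (P : Measure Ω) : Prop where
  measurable : ∀ l t, Measurable (B l t)
  isBrownianReal : ∀ l, IsBrownianReal (B l) P
  indep : iIndepFun (fun l ω t => B l t ω) P

/-- The pairs `(1_{[0,t]} e_l, Bˡ_t)`, `t ≤ T`, in `L²([0,T]; ℝᵈ) × L²(P)`. -/
def incrementPairs (B : Fin d → ℝ≥0 → Ω → ℝ) (P : Measure Ω) (T : ℝ≥0) :
    Set (PathSpace d T × Lp ℝ 2 P) :=
  {p | ∃ (l : Fin d) (t : ℝ≥0), t ≤ T ∧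
    p.1 = indicatorConstLp 2 (measurableSet_Icc (a := (0 : ℝ)) (b := (t : ℝ)))
      (measure_ne_top _ _) (EuclideanSpace.single l (1 : ℝ)) ∧
    ⇑p.2 =ᵐ[P] B l t}

/-- `W` is the Wiener integral `B(h) = ∑ₗ ∫₀ᵀ hˡ(t) dBˡ_t`. The graph of `h ↦ B(h)` is the closed
linear span of the pairs `(1_{[0,t]} e_l, Bˡ_t)`, that is, `h ↦ B(h)` is the continuous linear
extension to `L²([0,T]; ℝᵈ)` of the elementary integral of step functions. -/
def IsWienerIntegral (B : Fin d → ℝ≥0 → Ω → ℝ) (P : Measure Ω) (T : ℝ≥0)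
    (h : PathSpace d T) (W : Lp ℝ 2 P) : Prop :=
  (h, W) ∈ closure (Submodule.span ℝ (incrementPairs B P T) : Set (PathSpace d T × Lp ℝ 2 P))

/-- The graph of the Malliavin derivative on smooth cylindrical functionals: the pairs `(F, DF)`
with `F = f(B(h₁), …, B(hₙ))` and `DF = ∑ᵢ ∂ᵢf(B(h₁), …, B(hₙ)) hᵢ`, where `f` is smooth and `f`
and all its derivatives have polynomial growth. -/
def cylindricalGraph (B : Fin d → ℝ≥0 → Ω → ℝ) (P : Measure Ω) (T : ℝ≥0) :
    Set (Lp ℝ 2 P × Lp (PathSpace d T) 2 P) :=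
  {p | ∃ (n : ℕ) (f : (Fin n → ℝ) → ℝ) (h : Fin n → PathSpace d T) (W : Fin n → Lp ℝ 2 P),
    f.HasTemperateGrowth ∧ (∀ i, IsWienerIntegral B P T (h i) (W i)) ∧
    (∀ᵐ ω ∂P, p.1 ω = f (fun i => W i ω)) ∧
    (∀ᵐ ω ∂P, p.2 ω = ∑ i, fderiv ℝ f (fun j => W j ω) (Pi.single i 1) • h i)}

/-- `F ∈ 𝔻^{1,2}` and `DF : Ω → L²([0,T]; ℝᵈ)` is (a version of) its Malliavin derivative: the
graph of the operator `D` is the closure in `L²(Ω) × L²(Ω; H)` of its graph on smooth cylindrical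
functionals. -/
def HasMalliavinDeriv (B : Fin d → ℝ≥0 → Ω → ℝ) (P : Measure Ω) (T : ℝ≥0)
    (F : Ω → ℝ) (DF : Ω → PathSpace d T) : Prop :=
  ∃ (hF : MemLp F 2 P) (hDF : MemLp DF 2 P),
    (hF.toLp F, hDF.toLp DF) ∈ closure (cylindricalGraph B P T)

/-- The Malliavin matrix `γ(i,j) = ⟨DXⁱ, DXʲ⟩` of a random vector with derivatives `DX`. -/
def malliavinMatrix {T : ℝ≥0} (DX : Fin m → Ω → PathSpace d T) (ω : Ω) :
    Matrix (Fin m) (Fin m) ℝ :=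
  Matrix.of fun i j => inner ℝ (DX i ω) (DX j ω)

/-- The vector field `u_k = ∑ⱼ γ⁻¹(k,j) DXʲ`, with values in `L²([0,T]; ℝᵈ)`. -/
def coveringField {T : ℝ≥0} (DX : Fin m → Ω → PathSpace d T) (k : Fin m) (ω : Ω) :
    PathSpace d T :=
  ∑ j, (malliavinMatrix DX ω)⁻¹ k j • DX j ω

end Malliavin

end

/-! The duality is linear algebra, pointwise on the event where the Malliavin matrix is invertible:
`⟨DXⁱ, u_k⟩` is the `(k,i)` entry of `γ⁻¹γ`. The last claim then reduces to the chain rule `D(φ(X))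
= ∑ⱼ ∂ⱼφ(X) DXʲ`, since pairing with `u_k` keeps only `j = k`.

The chain rule is proved by showing that the pair (`φ(X)`, `∑ⱼ ∂ⱼφ(X) DXʲ`) stays in the closed
graph of `D`. For smooth `φ` and cylindrical `X` it is the classical chain rule
(`mem_cylindricalGraph_of_chain`). General `X` is reached along cylindrical approximations, and `C¹`
functions `φ` by mollification. Both limits are instances of `tendsto_chainPair`: the coefficients
are bounded and converge almost surely, while the derivatives converge in `L²`. -/

open Filter Topology
open scoped Convolution

/-! ### Convergence in `L²` -/

section Convergence

variable {Ω E : Type*} [MeasurableSpace Ω] {P : Measure Ω} [NormedAddCommGroup E]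

/-- Dominated convergence in `L²`. -/
theorem tendsto_eLpNorm_two_zero_of_dominated {f : ℕ → Ω → E} {g : Ω → ℝ}
    (hf : ∀ n, AEStronglyMeasurable (f n) P) (hg : MemLp g 2 P)
    (hfg : ∀ n, ∀ᵐ ω ∂P, ‖f n ω‖ ≤ g ω)
    (hlim : ∀ᵐ ω ∂P, Tendsto (fun n => f n ω) atTop (𝓝 0)) :
    Tendsto (fun n => eLpNorm (f n) 2 P) atTop (𝓝 0) := by
  have key : Tendsto (fun n => ∫⁻ ω, ‖f n ω‖ₑ ^ (2 : ℝ) ∂P) atTop (𝓝 (∫⁻ _, 0 ∂P)) := by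
    refine tendsto_lintegral_of_dominated_convergence' (fun ω => ‖g ω‖ₑ ^ (2 : ℝ))
      (fun n => (hf n).enorm.pow_const _) (fun n => ?_) ?_ ?_
    · filter_upwards [hfg n] with ω hω
      gcongr
      rw [enorm_le_iff_norm_le]
      exact hω.trans (le_abs_self _)
    · have := lintegral_rpow_enorm_lt_top_of_eLpNorm_lt_top two_ne_zero ENNReal.ofNat_ne_top hg.2
      simpa using this.ne
    · filter_upwards [hlim] with ω hω
      have h1 := (ENNReal.continuous_rpow_const (y := 2)).tendsto _ |>.comp hω.enorm
      simpa [Function.comp_def] using h1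
  have h2 := (ENNReal.continuous_rpow_const (y := (1 / 2 : ℝ))).tendsto _ |>.comp key
  simp only [lintegral_const, zero_mul] at h2
  rw [ENNReal.zero_rpow_of_pos (by norm_num)] at h2
  refine h2.congr fun n => ?_
  rw [eLpNorm_eq_lintegral_rpow_enorm_toReal two_ne_zero ENNReal.ofNat_ne_top]
  simp

theorem memLp_smul_of_bounded [NormedSpace ℝ E] {a : Ω → ℝ} {Y : Ω → E} {C : ℝ}
    (ha : AEStronglyMeasurable a P) (haC : ∀ ω, |a ω| ≤ C) (hY : MemLp Y 2 P) :
    MemLp (fun ω => a ω • Y ω) 2 P := by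
  refine hY.of_le_mul (c := C) (ha.smul hY.1) (ae_of_all _ fun ω => ?_)
  rw [norm_smul, Real.norm_eq_abs]
  gcongr
  exact haC ω

/-- Products of uniformly bounded, almost everywhere convergent coefficients with an `L²`-convergent
sequence converge in `L²`. -/
theorem tendsto_eLpNorm_smul_sub_smul [NormedSpace ℝ E] {a : ℕ → Ω → ℝ} {b : Ω → ℝ}
    {Y : ℕ → Ω → E} {Z : Ω → E} {C : ℝ}
    (ha : ∀ n, AEStronglyMeasurable (a n) P) (hb : AEStronglyMeasurable b P)
    (haC : ∀ n ω, |a n ω| ≤ C) (hbC : ∀ ω, |b ω| ≤ C)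
    (hab : ∀ᵐ ω ∂P, Tendsto (fun n => a n ω) atTop (𝓝 (b ω)))
    (hY : ∀ n, MemLp (Y n) 2 P) (hZ : MemLp Z 2 P)
    (hYZ : Tendsto (fun n => eLpNorm (fun ω => Y n ω - Z ω) 2 P) atTop (𝓝 0)) :
    Tendsto (fun n => eLpNorm (fun ω => a n ω • Y n ω - b ω • Z ω) 2 P) atTop (𝓝 0) := by
  -- The difference splits as `aₙ(Yₙ - Z) + (aₙ - b)Z`: the first term is at most `C‖Yₙ - Z‖`, the
  -- second is dominated by `2C‖Z‖`.
  have h1 : Tendsto (fun n => eLpNorm (fun ω => a n ω • (Y n ω - Z ω)) 2 P) atTop (𝓝 0) := by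
    have hlim := ENNReal.Tendsto.const_mul (a := ENNReal.ofReal C) hYZ (Or.inr ENNReal.ofReal_ne_top)
    rw [mul_zero] at hlim
    refine tendsto_of_tendsto_of_tendsto_of_le_of_le tendsto_const_nhds hlim
      (fun _ => zero_le) fun n => ?_
    refine eLpNorm_le_mul_eLpNorm_of_ae_le_mul (ae_of_all _ fun ω => ?_) 2
    rw [norm_smul, Real.norm_eq_abs]
    gcongr
    exact haC n ω
  have h2 : Tendsto (fun n => eLpNorm (fun ω => (a n ω - b ω) • Z ω) 2 P) atTop (𝓝 0) := by
    refine tendsto_eLpNorm_two_zero_of_dominated (g := fun ω => (C + C) * ‖Z ω‖)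
      (fun n => ((ha n).sub hb).smul hZ.1) (hZ.norm.const_mul _)
      (fun n => ae_of_all _ fun ω => ?_) ?_
    · rw [norm_smul, Real.norm_eq_abs]
      gcongr
      exact (abs_sub _ _).trans (add_le_add (haC n ω) (hbC ω))
    · filter_upwards [hab] with ω hω
      simpa using (hω.sub_const (b ω)).smul_const (Z ω)
  have h3 := h1.add h2
  rw [add_zero] at h3
  refine tendsto_of_tendsto_of_tendsto_of_le_of_le tendsto_const_nhds h3
    (fun _ => zero_le) fun n => ?_
  have e : (fun ω => a n ω • Y n ω - b ω • Z ω)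
      = (fun ω => a n ω • (Y n ω - Z ω)) + fun ω => (a n ω - b ω) • Z ω := by
    funext ω
    simp only [Pi.add_apply, smul_sub, sub_smul]
    abel
  simp only [e]
  exact eLpNorm_add_le ((ha n).smul ((hY n).1.sub hZ.1)) (((ha n).sub hb).smul hZ.1) (by norm_num)

/-- Convergence in `L²` of linear combinations with bounded convergent coefficients. -/
theorem tendsto_Lp_of_sum_smul [NormedSpace ℝ E] {ι : Type*} [Fintype ι] {q : ℕ → Lp E 2 P}
    {r : Lp E 2 P}
    {a : ι → ℕ → Ω → ℝ} {b : ι → Ω → ℝ} {Y : ι → ℕ → Ω → E} {Z : ι → Ω → E} {C : ℝ}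
    (ha : ∀ j n, AEStronglyMeasurable (a j n) P) (hb : ∀ j, AEStronglyMeasurable (b j) P)
    (haC : ∀ j n ω, |a j n ω| ≤ C) (hbC : ∀ j ω, |b j ω| ≤ C)
    (hab : ∀ j, ∀ᵐ ω ∂P, Tendsto (fun n => a j n ω) atTop (𝓝 (b j ω)))
    (hY : ∀ j n, MemLp (Y j n) 2 P) (hZ : ∀ j, MemLp (Z j) 2 P)
    (hYZ : ∀ j, Tendsto (fun n => eLpNorm (fun ω => Y j n ω - Z j ω) 2 P) atTop (𝓝 0))
    (hq : ∀ n, q n =ᵐ[P] fun ω => ∑ j, a j n ω • Y j n ω)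
    (hr : r =ᵐ[P] fun ω => ∑ j, b j ω • Z j ω) :
    Tendsto q atTop (𝓝 r) := by
  rw [Lp.tendsto_Lp_iff_tendsto_eLpNorm']
  have h := tendsto_finsetSum Finset.univ fun j (_ : j ∈ Finset.univ) =>
    tendsto_eLpNorm_smul_sub_smul (ha j) (hb j) (haC j) (hbC j) (hab j) (hY j) (hZ j) (hYZ j)
  rw [Finset.sum_const_zero] at h
  refine tendsto_of_tendsto_of_tendsto_of_le_of_le tendsto_const_nhds h
    (fun _ => zero_le) fun n => ?_
  have e : (⇑(q n) - ⇑r) =ᵐ[P] ∑ j, fun ω => a j n ω • Y j n ω - b j ω • Z j ω := by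
    filter_upwards [hq n, hr] with ω h1 h2
    simp [h1, h2]
  rw [eLpNorm_congr_ae e]
  exact eLpNorm_sum_le (fun j _ => ((ha j n).smul (hY j n).1).sub ((hb j).smul (hZ j).1))
    (by norm_num)

/-- Finitely many `L²`-convergent sequences have a common almost everywhere convergent
subsequence. -/
theorem exists_strictMono_forall_tendsto_ae {ι : Type*} [Fintype ι] {p : ι → ℕ → Lp ℝ 2 P}
    {x : ι → Lp ℝ 2 P} (h : ∀ j, Tendsto (p j) atTop (𝓝 (x j))) :
    ∃ ns : ℕ → ℕ, StrictMono ns ∧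
      ∀ j, ∀ᵐ ω ∂P, Tendsto (fun n => p j (ns n) ω) atTop (𝓝 (x j ω)) := by
  -- A single sequence controls all indices at once, so one extraction serves every `j`.
  have hS : Tendsto (fun n => ∑ j, |p j n - x j|) atTop (𝓝 0) := by
    have := tendsto_finsetSum Finset.univ fun j (_ : j ∈ Finset.univ) =>
      ((h j).sub_const (x j)).sup_nhds ((h j).sub_const (x j)).neg
    simpa [abs] using this
  obtain ⟨ns, hns, hlim⟩ := (tendstoInMeasure_of_tendsto_Lp hS).exists_seq_tendsto_ae
  refine ⟨ns, hns, fun j => ?_⟩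
  have hsum : ∀ᵐ ω ∂P, ∀ n, (∑ j, |p j n - x j| : Lp ℝ 2 P) ω = ∑ j, |p j n ω - x j ω| := by
    rw [ae_all_iff]
    intro n
    have h1 : ∀ᵐ ω ∂P, ∀ j, (|p j n - x j| : Lp ℝ 2 P) ω = |p j n ω - x j ω| := by
      rw [ae_all_iff]
      intro j
      filter_upwards [Lp.coeFn_abs (p j n - x j), Lp.coeFn_sub (p j n) (x j)] with ω h1 h2
      rw [h1, h2, Pi.sub_apply]
    filter_upwards [h1, Lp.coeFn_finsetSum Finset.univ (fun j => |p j n - x j|)] with ω h1 h2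
    rw [h2, Finset.sum_apply]
    exact Finset.sum_congr rfl fun j _ => h1 j
  filter_upwards [hlim, hsum, Lp.coeFn_zero ℝ 2 P] with ω h1 h2 h3
  rw [h3] at h1
  simp only [h2, Pi.zero_apply] at h1
  rw [tendsto_iff_dist_tendsto_zero]
  refine squeeze_zero (fun _ => dist_nonneg) (fun n => ?_) h1
  exact Finset.single_le_sum (f := fun j => |p j (ns n) ω - x j ω|)
    (fun _ _ => abs_nonneg _) (Finset.mem_univ j)

end Convergence

/-! ### Mollification of compactly supported `C¹` functions -/

section Mollification

variable {m : ℕ}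

/-- A compactly supported `C¹` function is a uniform `C¹` limit of smooth compactly supported
functions. -/
theorem exists_contDiff_hasCompactSupport_C1_approx {φ : (Fin m → ℝ) → ℝ} (hφ : ContDiff ℝ 1 φ)
    (hc : HasCompactSupport φ) {ε : ℝ} (hε : 0 < ε) :
    ∃ ψ : (Fin m → ℝ) → ℝ, ContDiff ℝ (⊤ : ℕ∞) ψ ∧ HasCompactSupport ψ ∧
      (∀ x, |ψ x - φ x| ≤ ε) ∧ ∀ x, ‖fderiv ℝ ψ x - fderiv ℝ φ x‖ ≤ ε := by
  have hφ' := hφ.continuous_fderiv one_ne_zero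
  obtain ⟨δ₁, hδ₁, h₁⟩ := Metric.uniformContinuous_iff.1
    (hc.uniformContinuous_of_continuous hφ.continuous) ε hε
  obtain ⟨δ₂, hδ₂, h₂⟩ := Metric.uniformContinuous_iff.1
    ((hc.fderiv ℝ).uniformContinuous_of_continuous hφ') ε hε
  -- The support radius lies within the moduli of continuity of both `φ` and its derivative.
  let ρ : ContDiffBump (0 : Fin m → ℝ) :=
    ⟨min δ₁ δ₂ / 2, min δ₁ δ₂, by positivity, half_lt_self (by positivity)⟩
  -- Differentiation falls on `φ`, so the derivative of the mollification is the mollification of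
  -- the derivative.
  have hder : ∀ x, fderiv ℝ (ρ.normed volume ⋆[ContinuousLinearMap.lsmul ℝ ℝ, volume] φ) x
      = (ρ.normed volume ⋆[ContinuousLinearMap.lsmul ℝ ℝ, volume] fderiv ℝ φ) x := fun x =>
    (hc.hasFDerivAt_convolution_right (ContinuousLinearMap.lsmul ℝ ℝ)
      ρ.continuous_normed.locallyIntegrable hφ x).fderiv
  refine ⟨ρ.normed volume ⋆[ContinuousLinearMap.lsmul ℝ ℝ, volume] φ, ?_, ?_, fun x => ?_,
    fun x => ?_⟩
  · exact ρ.hasCompactSupport_normed.contDiff_convolution_left _ ρ.contDiff_normed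
      hφ.continuous.locallyIntegrable
  · exact ρ.hasCompactSupport_normed.convolution _ hc
  · exact ρ.dist_normed_convolution_le hφ.continuous.aestronglyMeasurable fun y hy =>
      (h₁ ((Metric.mem_ball.1 hy).trans_le (min_le_left _ _))).le
  · rw [hder, ← dist_eq_norm]
    exact ρ.dist_normed_convolution_le hφ'.aestronglyMeasurable fun y hy =>
      (h₂ ((Metric.mem_ball.1 hy).trans_le (min_le_right _ _))).le

/-- A compactly supported `C¹` function and its partial derivatives are bounded. -/
theorem exists_bound_of_hasCompactSupport_C1 {φ : (Fin m → ℝ) → ℝ} (hφ : ContDiff ℝ 1 φ)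
    (hc : HasCompactSupport φ) :
    ∃ C : ℝ, (∀ x, |φ x| ≤ C) ∧ ∀ j x, |fderiv ℝ φ x (Pi.single j 1)| ≤ C := by
  obtain ⟨C₁, h₁⟩ := hc.exists_bound_of_continuous hφ.continuous
  obtain ⟨C₂, h₂⟩ := (hc.fderiv ℝ).exists_bound_of_continuous (hφ.continuous_fderiv one_ne_zero)
  refine ⟨max C₁ C₂, fun x => (h₁ x).trans (le_max_left _ _), fun j x => ?_⟩
  refine ((fderiv ℝ φ x).le_opNorm _).trans ?_
  rw [Pi.norm_single, norm_one, mul_one]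
  exact (h₂ x).trans (le_max_right _ _)

end Mollification

/-! ### Chain rule on cylindrical functionals -/

namespace Malliavin

variable {Ω : Type*} [MeasurableSpace Ω] {P : Measure Ω} {d m : ℕ} {T : ℝ≥0}
  {B : Fin d → ℝ≥0 → Ω → ℝ}

theorem hasTemperateGrowth_pi {E : Type*} [NormedAddCommGroup E] [NormedSpace ℝ E]
    {f : Fin m → E → ℝ} (hf : ∀ j, (f j).HasTemperateGrowth) :
    Function.HasTemperateGrowth fun x j => f j x := by
  have e : (fun x j => f j x) =
      fun x => ∑ j, (ContinuousLinearMap.toSpanSingleton ℝ (Pi.single j 1 : Fin m → ℝ)) (f j x) := by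
    funext x j
    simp [Finset.sum_apply, Pi.single_apply]
  rw [e]
  exact .sum fun j _ => (ContinuousLinearMap.hasTemperateGrowth _).comp (hf j)

/-- The cylindrical functionals are stable under smooth compactly supported functions, with the
chain rule. -/
theorem mem_cylindricalGraph_of_chain {φ : (Fin m → ℝ) → ℝ} (hφ : ContDiff ℝ (⊤ : ℕ∞) φ)
    (hc : HasCompactSupport φ) {p : Fin m → Lp ℝ 2 P × Lp (PathSpace d T) 2 P}
    (hp : ∀ j, p j ∈ cylindricalGraph B P T) {q : Lp ℝ 2 P × Lp (PathSpace d T) 2 P}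
    (h₁ : ∀ᵐ ω ∂P, q.1 ω = φ (fun i => (p i).1 ω))
    (h₂ : ∀ᵐ ω ∂P, q.2 ω =
      ∑ j, fderiv ℝ φ (fun i => (p i).1 ω) (Pi.single j 1) • (p j).2 ω) :
    q ∈ cylindricalGraph B P T := by
  choose n f h W hf hW hp₁ hp₂ using hp
  -- The Wiener integrals of all components are concatenated into one family; `π j` recovers the
  -- block belonging to the `j`-th component.
  let e := Fintype.equivFin (Σ j, Fin (n j))
  let π (j : Fin m) : (Fin (Fintype.card (Σ j, Fin (n j))) → ℝ) →L[ℝ] (Fin (n j) → ℝ) :=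
    ContinuousLinearMap.pi fun i => ContinuousLinearMap.proj (e ⟨j, i⟩)
  let F : (Fin (Fintype.card (Σ j, Fin (n j))) → ℝ) → Fin m → ℝ := fun x j => f j (π j x)
  have hF : F.HasTemperateGrowth :=
    hasTemperateGrowth_pi fun j => (hf j).comp (π j).hasTemperateGrowth
  have hφF : Function.HasTemperateGrowth fun x => φ (F x) := (hc.hasTemperateGrowth hφ).comp hF
  have hFd : ∀ x, HasFDerivAt F
      (ContinuousLinearMap.pi fun j => (fderiv ℝ (f j) (π j x)).comp (π j)) x := fun x =>
    hasFDerivAt_pi.2 fun j =>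
      (((hf j).1.differentiable (by simp)) (π j x)).hasFDerivAt.comp x (π j).hasFDerivAt
  have hd : ∀ x j i, fderiv ℝ (fun x => φ (F x)) x (Pi.single (e ⟨j, i⟩) 1) =
      fderiv ℝ φ (F x) (Pi.single j 1) * fderiv ℝ (f j) (π j x) (Pi.single i 1) := by
    intro x j i
    have h1 := ((hφ.differentiable (by simp)) (F x)).hasFDerivAt.comp x (hFd x)
    have h1' := h1.fderiv
    rw [Function.comp_def] at h1'
    rw [h1', ContinuousLinearMap.comp_apply]
    have h2 : (ContinuousLinearMap.pi fun j => (fderiv ℝ (f j) (π j x)).comp (π j))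
        (Pi.single (e ⟨j, i⟩) 1) =
        fderiv ℝ (f j) (π j x) (Pi.single i 1) • (Pi.single j 1 : Fin m → ℝ) := by
      funext j'
      rw [ContinuousLinearMap.pi_apply, ContinuousLinearMap.comp_apply]
      rcases eq_or_ne j' j with rfl | hj
      · have : π j' (Pi.single (e ⟨j', i⟩) 1) = Pi.single i 1 := by
          funext i'
          simp [π, Pi.single_apply]
        simp [this]
      · have : π j' (Pi.single (e ⟨j, i⟩) 1) = 0 := by
          funext i'
          simp [π, hj]
        simp [this, hj]
    rw [h2, map_smul, smul_eq_mul, mul_comm]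
  have hπ : ∀ ω j, π j (fun a => W (e.symm a).1 (e.symm a).2 ω) = fun i => W j i ω := by
    intro ω j
    funext i
    simp only [π, ContinuousLinearMap.coe_pi', ContinuousLinearMap.proj_apply]
    rw [e.symm_apply_apply]
  refine ⟨_, fun x => φ (F x), fun a => h (e.symm a).1 (e.symm a).2,
    fun a => W (e.symm a).1 (e.symm a).2, hφF, fun a => hW _ _, ?_, ?_⟩
  · filter_upwards [h₁, ae_all_iff.2 hp₁] with ω h1 h3
    rw [h1]
    simp only [F, hπ, h3]
  · filter_upwards [h₂, ae_all_iff.2 hp₁, ae_all_iff.2 hp₂] with ω h2 h3 h4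
    rw [h2, ← e.sum_comp, Fintype.sum_sigma]
    refine Finset.sum_congr rfl fun j _ => ?_
    rw [h4 j, Finset.smul_sum]
    refine Finset.sum_congr rfl fun i _ => ?_
    rw [hd, smul_smul, e.symm_apply_apply, hπ]
    simp only [F, hπ, h3]
-- Chain rule on the closed graph
section ChainRule


theorem aestronglyMeasurable_comp_pi {ψ : (Fin m → ℝ) → ℝ} (hψ : Continuous ψ)
    {X : Fin m → Ω → ℝ} (hX : ∀ i, AEStronglyMeasurable (X i) P) :
    AEStronglyMeasurable (fun ω => ψ fun i => X i ω) P :=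
  hψ.comp_aestronglyMeasurable
    (aemeasurable_pi_lambda _ fun i => (hX i).aemeasurable).aestronglyMeasurable

theorem continuous_partialDeriv {φ : (Fin m → ℝ) → ℝ} (hφ : ContDiff ℝ 1 φ) (j : Fin m) :
    Continuous fun x => fderiv ℝ φ x (Pi.single j 1) :=
  (hφ.continuous_fderiv one_ne_zero).clm_apply continuous_const

theorem memLp_chain_of_hasCompactSupport {φ : (Fin m → ℝ) → ℝ} (hφ : ContDiff ℝ 1 φ)
    (hc : HasCompactSupport φ) {X : Fin m → Ω → ℝ} (hX : ∀ i, AEStronglyMeasurable (X i) P)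
    {DX : Fin m → Ω → PathSpace d T} (hDX : ∀ i, MemLp (DX i) 2 P) :
    MemLp (fun ω => ∑ j, fderiv ℝ φ (fun i => X i ω) (Pi.single j 1) • DX j ω) 2 P := by
  obtain ⟨C, -, hC⟩ := exists_bound_of_hasCompactSupport_C1 hφ hc
  exact memLp_finsetSum _ fun j _ => memLp_smul_of_bounded
    (aestronglyMeasurable_comp_pi (continuous_partialDeriv hφ j) hX) (fun ω => hC j _) (hDX j)

variable [IsProbabilityMeasure P]

theorem memLp_comp_of_hasCompactSupport {φ : (Fin m → ℝ) → ℝ} (hφ : ContDiff ℝ 1 φ)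
    (hc : HasCompactSupport φ) {X : Fin m → Ω → ℝ} (hX : ∀ i, AEStronglyMeasurable (X i) P) :
    MemLp (fun ω => φ fun i => X i ω) 2 P := by
  obtain ⟨C, hC, -⟩ := exists_bound_of_hasCompactSupport_C1 hφ hc
  exact .of_bound (aestronglyMeasurable_comp_pi hφ.continuous hX) C (ae_of_all _ fun ω => hC _)

/-- The pair of `φ(X)` and `∑ⱼ ∂ⱼφ(X) DXʲ` as an element of `L²(Ω) × L²(Ω; H)`. -/
noncomputable def chainPair {φ : (Fin m → ℝ) → ℝ} (hφ : ContDiff ℝ 1 φ) (hc : HasCompactSupport φ)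
    (p : Fin m → Lp ℝ 2 P × Lp (PathSpace d T) 2 P) : Lp ℝ 2 P × Lp (PathSpace d T) 2 P :=
  ((memLp_comp_of_hasCompactSupport hφ hc fun i => Lp.aestronglyMeasurable (p i).1).toLp _,
    (memLp_chain_of_hasCompactSupport hφ hc (fun i => Lp.aestronglyMeasurable (p i).1)
      fun i => Lp.memLp (p i).2).toLp _)

theorem chainPair_fst_ae {φ : (Fin m → ℝ) → ℝ} (hφ : ContDiff ℝ 1 φ) (hc : HasCompactSupport φ)
    (p : Fin m → Lp ℝ 2 P × Lp (PathSpace d T) 2 P) :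
    ∀ᵐ ω ∂P, (chainPair hφ hc p).1 ω = φ fun i => (p i).1 ω :=
  MemLp.coeFn_toLp (memLp_comp_of_hasCompactSupport hφ hc fun i => Lp.aestronglyMeasurable (p i).1)

theorem chainPair_snd_ae {φ : (Fin m → ℝ) → ℝ} (hφ : ContDiff ℝ 1 φ) (hc : HasCompactSupport φ)
    (p : Fin m → Lp ℝ 2 P × Lp (PathSpace d T) 2 P) :
    ∀ᵐ ω ∂P, (chainPair hφ hc p).2 ω =
      ∑ j, fderiv ℝ φ (fun i => (p i).1 ω) (Pi.single j 1) • (p j).2 ω :=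
  MemLp.coeFn_toLp (memLp_chain_of_hasCompactSupport hφ hc
    (fun i => Lp.aestronglyMeasurable (p i).1) fun i => Lp.memLp (p i).2)

/-- Function and random vector may both vary, so that the lemma covers approximating `X` with `φ`
fixed as well as approximating `φ` with `X` fixed. -/
theorem tendsto_chainPair {φ : ℕ → (Fin m → ℝ) → ℝ} {ψ : (Fin m → ℝ) → ℝ}
    (hφ : ∀ n, ContDiff ℝ 1 (φ n)) (hφc : ∀ n, HasCompactSupport (φ n))
    (hψ : ContDiff ℝ 1 ψ) (hψc : HasCompactSupport ψ)
    {p : ℕ → Fin m → Lp ℝ 2 P × Lp (PathSpace d T) 2 P}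
    {r : Fin m → Lp ℝ 2 P × Lp (PathSpace d T) 2 P} {C : ℝ}
    (hC : ∀ n x, |φ n x| ≤ C) (hC' : ∀ n j x, |fderiv ℝ (φ n) x (Pi.single j 1)| ≤ C)
    (hD : ∀ x, |ψ x| ≤ C) (hD' : ∀ j x, |fderiv ℝ ψ x (Pi.single j 1)| ≤ C)
    (hlim : ∀ᵐ ω ∂P, Tendsto (fun n => φ n fun i => (p n i).1 ω) atTop
      (𝓝 (ψ fun i => (r i).1 ω)))
    (hlim' : ∀ j, ∀ᵐ ω ∂P, Tendsto
      (fun n => fderiv ℝ (φ n) (fun i => (p n i).1 ω) (Pi.single j 1)) atTop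
      (𝓝 (fderiv ℝ ψ (fun i => (r i).1 ω) (Pi.single j 1))))
    (hpr : ∀ j, Tendsto (fun n => (p n j).2) atTop (𝓝 (r j).2)) :
    Tendsto (fun n => chainPair (hφ n) (hφc n) (p n)) atTop (𝓝 (chainPair hψ hψc r)) := by
  refine Tendsto.prodMk_nhds ?_ ?_
  -- The first component is a one-term combination with the constant vector `1`, which is in `L²`
  -- because `P` is finite.
  · refine tendsto_Lp_of_sum_smul (ι := Unit) (C := C)
      (a := fun _ n ω => φ n fun i => (p n i).1 ω) (b := fun _ ω => ψ fun i => (r i).1 ω)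
      (Y := fun _ _ _ => (1 : ℝ)) (Z := fun _ _ => (1 : ℝ))
      (fun _ n => aestronglyMeasurable_comp_pi (hφ n).continuous
        fun i => Lp.aestronglyMeasurable (p n i).1)
      (fun _ => aestronglyMeasurable_comp_pi hψ.continuous fun i => Lp.aestronglyMeasurable (r i).1)
      (fun _ n ω => hC n _) (fun _ ω => hD _) (fun _ => hlim)
      (fun _ _ => memLp_const _) (fun _ => memLp_const _) (fun _ => by simp) (fun n => ?_) ?_
    · filter_upwards [chainPair_fst_ae (hφ n) (hφc n) (p n)] with ω hω
      exact hω.trans (by simp)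
    · filter_upwards [chainPair_fst_ae hψ hψc r] with ω hω
      exact hω.trans (by simp)
  · refine tendsto_Lp_of_sum_smul (C := C)
      (a := fun j n ω => fderiv ℝ (φ n) (fun i => (p n i).1 ω) (Pi.single j 1))
      (b := fun j ω => fderiv ℝ ψ (fun i => (r i).1 ω) (Pi.single j 1))
      (Y := fun j n => (p n j).2) (Z := fun j => (r j).2)
      (fun j n => aestronglyMeasurable_comp_pi (continuous_partialDeriv (hφ n) j)
        fun i => Lp.aestronglyMeasurable (p n i).1)
      (fun j => aestronglyMeasurable_comp_pi (continuous_partialDeriv hψ j)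
        fun i => Lp.aestronglyMeasurable (r i).1)
      (fun j n ω => hC' n j _) (fun j ω => hD' j _) hlim'
      (fun j n => Lp.memLp _) (fun j => Lp.memLp _)
      (fun j => (Lp.tendsto_Lp_iff_tendsto_eLpNorm' _ _).1 (hpr j))
      (fun n => chainPair_snd_ae (hφ n) (hφc n) (p n)) (chainPair_snd_ae hψ hψc r)

/-- Cylindrical approximations of `r` converge almost surely along a common subsequence, and
continuity of `φ` and its partial derivatives carries this to the coefficients. -/
theorem chainPair_mem_closure_of_smooth {φ : (Fin m → ℝ) → ℝ} (hφ : ContDiff ℝ (⊤ : ℕ∞) φ)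
    (hφ₁ : ContDiff ℝ 1 φ) (hc : HasCompactSupport φ)
    {r : Fin m → Lp ℝ 2 P × Lp (PathSpace d T) 2 P}
    (hr : ∀ j, r j ∈ closure (cylindricalGraph B P T)) :
    chainPair hφ₁ hc r ∈ closure (cylindricalGraph B P T) := by
  simp only [mem_closure_iff_seq_limit] at hr
  choose p hp hlim using hr
  obtain ⟨ns, hns, hae⟩ := exists_strictMono_forall_tendsto_ae
    (p := fun j n => (p j n).1) (x := fun j => (r j).1)
    fun j => (continuous_fst.tendsto _).comp (hlim j)
  obtain ⟨C, hC, hC'⟩ := exists_bound_of_hasCompactSupport_C1 hφ₁ hc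
  have hae' : ∀ᵐ ω ∂P, Tendsto (fun n i => (p i (ns n)).1 ω) atTop (𝓝 fun i => (r i).1 ω) := by
    filter_upwards [ae_all_iff.2 hae] with ω hω
    exact tendsto_pi_nhds.2 hω
  refine mem_closure_of_tendsto (tendsto_chainPair (p := fun n j => p j (ns n)) (C := C)
    (fun _ => hφ₁) (fun _ => hc) hφ₁ hc (fun _ => hC) (fun _ => hC') hC hC' ?_ (fun j => ?_)
    fun j => (continuous_snd.tendsto _).comp ((hlim j).comp hns.tendsto_atTop))
    (Eventually.of_forall fun n => mem_cylindricalGraph_of_chain hφ hc (fun j => hp j (ns n))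
      (chainPair_fst_ae hφ₁ hc _) (chainPair_snd_ae hφ₁ hc _))
  · filter_upwards [hae'] with ω hω
    exact (hφ₁.continuous.tendsto _).comp hω
  · filter_upwards [hae'] with ω hω
    exact ((continuous_partialDeriv hφ₁ j).tendsto _).comp hω

theorem chainPair_mem_closure {φ : (Fin m → ℝ) → ℝ} (hφ : ContDiff ℝ 1 φ)
    (hc : HasCompactSupport φ) {r : Fin m → Lp ℝ 2 P × Lp (PathSpace d T) 2 P}
    (hr : ∀ j, r j ∈ closure (cylindricalGraph B P T)) :
    chainPair hφ hc r ∈ closure (cylindricalGraph B P T) := by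
  choose ψ hψ hψc h₀ h₁ using fun n : ℕ =>
    exists_contDiff_hasCompactSupport_C1_approx hφ hc (ε := 1 / ((n : ℝ) + 1)) (by positivity)
  have hψ₁ : ∀ n, ContDiff ℝ 1 (ψ n) := fun n => (hψ n).of_le (by exact_mod_cast le_top)
  have h₁' : ∀ n j x, |fderiv ℝ (ψ n) x (Pi.single j 1) - fderiv ℝ φ x (Pi.single j 1)| ≤
      1 / ((n : ℝ) + 1) := by
    intro n j x
    have := (fderiv ℝ (ψ n) x - fderiv ℝ φ x).le_opNorm (Pi.single j 1)
    rw [Pi.norm_single, norm_one, mul_one] at this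
    exact this.trans (h₁ n x)
  have hle : ∀ n : ℕ, 1 / ((n : ℝ) + 1) ≤ 1 := fun n => by
    rw [div_le_one (by positivity)]
    linarith [n.cast_nonneg (α := ℝ)]
  -- Errors of at most `1` keep all mollified functions and their partial derivatives under the
  -- common bound `C + 1`.
  have hbound : ∀ {a b C : ℝ} {n : ℕ}, |a - b| ≤ 1 / ((n : ℝ) + 1) → |b| ≤ C → |a| ≤ C + 1 := by
    intro a b C n h h'
    linarith [abs_sub_abs_le_abs_sub a b, hle n]
  have hconv : ∀ {a : ℕ → ℝ} {b : ℝ}, (∀ n, |a n - b| ≤ 1 / ((n : ℝ) + 1)) →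
      Tendsto a atTop (𝓝 b) := by
    intro a b h
    rw [tendsto_iff_dist_tendsto_zero]
    exact squeeze_zero (fun _ => dist_nonneg) h tendsto_one_div_add_atTop_nhds_zero_nat
  obtain ⟨C, hC, hC'⟩ := exists_bound_of_hasCompactSupport_C1 hφ hc
  refine isClosed_closure.mem_of_tendsto (tendsto_chainPair (p := fun _ => r) (C := C + 1)
    hψ₁ hψc hφ hc (fun n x => hbound (h₀ n x) (hC x)) (fun n j x => hbound (h₁' n j x) (hC' j x))
    (fun x => (hC x).trans (by linarith)) (fun j x => (hC' j x).trans (by linarith))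
    (ae_of_all _ fun ω => hconv fun n => h₀ n _)
    (fun j => ae_of_all _ fun ω => hconv fun n => h₁' n j _) fun j => tendsto_const_nhds)
    (Eventually.of_forall fun n => chainPair_mem_closure_of_smooth (hψ n) (hψ₁ n) (hψc n) hr)

/-- The chain rule of the Malliavin derivative for compactly supported `C¹` functions. -/
theorem HasMalliavinDeriv.comp {φ : (Fin m → ℝ) → ℝ} (hφ : ContDiff ℝ 1 φ)
    (hc : HasCompactSupport φ) {X : Fin m → Ω → ℝ} {DX : Fin m → Ω → PathSpace d T}
    (hX : ∀ i, HasMalliavinDeriv B P T (X i) (DX i)) :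
    HasMalliavinDeriv B P T (fun ω => φ fun i => X i ω)
      fun ω => ∑ j, fderiv ℝ φ (fun i => X i ω) (Pi.single j 1) • DX j ω := by
  choose hF hDF hmem using hX
  refine ⟨memLp_comp_of_hasCompactSupport hφ hc fun i => (hF i).1,
    memLp_chain_of_hasCompactSupport hφ hc (fun i => (hF i).1) hDF, ?_⟩
  have h₁ : ∀ᵐ ω ∂P, (fun i => (hF i).toLp (X i) ω) = fun i => X i ω := by
    filter_upwards [ae_all_iff.2 fun i => (hF i).coeFn_toLp] with ω hω
    exact funext hω
  -- `chainPair` is built from the `L²` classes of `X` and `DX`; it remains to compare with the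
  -- given representatives almost everywhere.
  convert chainPair_mem_closure hφ hc hmem using 1
  refine Prod.ext (Lp.ext ?_) (Lp.ext ?_)
  · filter_upwards [h₁, chainPair_fst_ae hφ hc fun i => ((hF i).toLp (X i), (hDF i).toLp (DX i)),
      MemLp.coeFn_toLp (memLp_comp_of_hasCompactSupport hφ hc fun i => (hF i).1)] with ω h h' h''
    rw [h', h'', h]
  · filter_upwards [h₁, ae_all_iff.2 fun i => (hDF i).coeFn_toLp,
      chainPair_snd_ae hφ hc fun i => ((hF i).toLp (X i), (hDF i).toLp (DX i)),
      MemLp.coeFn_toLp (memLp_chain_of_hasCompactSupport hφ hc (fun i => (hF i).1) hDF)]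
      with ω h h' h'' h'''
    rw [h'', h''']
    simp only [h, h']

end ChainRule

/-! ### Duality and the covering property -/

/-- The vector field `u_k` is dual to the derivatives `DXⁱ` where the Malliavin matrix is
invertible. -/
theorem inner_coveringField {Ω : Type*} {d m : ℕ} {T : ℝ≥0} {DX : Fin m → Ω → PathSpace d T}
    {ω : Ω} (h : IsUnit (malliavinMatrix DX ω)) (i k : Fin m) :
    inner ℝ (DX i ω) (coveringField DX k ω) = if i = k then (1 : ℝ) else 0 := by
  have h1 : ((malliavinMatrix DX ω)⁻¹ * malliavinMatrix DX ω) k i = if i = k then (1 : ℝ) else 0 := by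
    rw [Matrix.nonsing_inv_mul _ ((Matrix.isUnit_iff_isUnit_det _).1 h), Matrix.one_apply]
    simp only [eq_comm]
  rw [← h1, coveringField, inner_sum, Matrix.mul_apply]
  refine Finset.sum_congr rfl fun j _ => ?_
  -- Symmetry of the inner product turns `γ(i,j)` into the entry `γ(j,i)` of the product `γ⁻¹γ`.
  rw [real_inner_smul_right, real_inner_comm]
  rfl

end Malliavin

theorem mainTheorem5 {Ω : Type*} [MeasurableSpace Ω] (P : Measure Ω) [IsProbabilityMeasure P]
    {d m : ℕ} (T : ℝ≥0) (B : Fin d → ℝ≥0 → Ω → ℝ) (hB : Malliavin.IsStandardBrownian B P)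
    (X : Fin m → Ω → ℝ) (DX : Fin m → Ω → Malliavin.PathSpace d T)
    (hX : ∀ i, Malliavin.HasMalliavinDeriv B P T (X i) (DX i))
    (hinv : ∀ᵐ ω ∂P, IsUnit (Malliavin.malliavinMatrix DX ω)) (k : Fin m) :
    (∀ i, ∀ᵐ ω ∂P,
      inner ℝ (DX i ω) (Malliavin.coveringField DX k ω) = if i = k then (1 : ℝ) else 0) ∧
    (∀ᵐ ω ∂P, inner ℝ (DX k ω) (Malliavin.coveringField DX k ω) = (1 : ℝ)) ∧
    (∀ φ : (Fin m → ℝ) → ℝ, ContDiff ℝ 1 φ → HasCompactSupport φ →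
      ∃ Dφ : Ω → Malliavin.PathSpace d T,
        Malliavin.HasMalliavinDeriv B P T (fun ω => φ (fun i => X i ω)) Dφ ∧
        ∀ᵐ ω ∂P, inner ℝ (Dφ ω) (Malliavin.coveringField DX k ω) =
          fderiv ℝ φ (fun i => X i ω) (Pi.single k 1)) := by
  refine ⟨fun i => ?_, ?_, fun φ hφ hc => ⟨_, Malliavin.HasMalliavinDeriv.comp hφ hc hX, ?_⟩⟩
  · filter_upwards [hinv] with ω hω
    exact Malliavin.inner_coveringField hω i k
  · filter_upwards [hinv] with ω hω
    simpa using Malliavin.inner_coveringField hω k k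
  · filter_upwards [hinv] with ω hω
    rw [sum_inner]
    simp [real_inner_smul_left, Malliavin.inner_coveringField hω]
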